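/- Let $A$ be a finite set, let $\Omega=A^{\mathbb Z}$ with its Borel $\sigma$-algebra $\mathcal F$, coordinates $\zeta_n(\omega)=\omega_n$ and left shift $T$, $(T\omega)_n=\omega_{n+1}$. Let $\mu$ be a stationary ($T$-invariant) probability measure on $\Omega$, and let $\mathcal D\subseteq\mathcal F$ be a $\sigma$-algebra that is shift-invariant (for every Borel $S$: $S\in\mathcal D\iff T(S)\in\mathcal D$) and contained, up to $\mu$-null sets, in the past $\sigma$-algebra $\mathcal F_{-\infty}^0=\sigma(\zeta_k:k<0)$ (every set of $\mathcal D$ is $\mu$-a.e. equal to a set of $\mathcal F_{-\infty}^0$; in particular this holds if $\mathcal D\subseteq\mathcal F_{-\infty}^0$). A decomposition of $\mu$ induced by $\mathcal D$ consists of a standard Borel space $\Theta$ with a probability measure $\lambda$ and probability measures $(\mu_\theta)_{\theta\in\Theta}$ on $\Omega$ such that $\theta\mapsto\mu_\theta(S)$ is measurable and $\mu(S)=\int_\Theta\mu_\theta(S)\,\lambda(d\theta)$ for all $S\in\mathcal F$, for which there is a measurable map $\alpha:\Omega\to\Theta$ with $\alpha_*\mu=\lambda$ such that: $\alpha$ is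 $\mu$-a.e. equal to a $\mathcal D$-measurable map; every $\mathcal D$-measurable map $f$ from $\Omega$ to a standard Borel space is of the form $f=\tilde f\circ\alpha$ $\mu$-a.s. with $\tilde f$ measurable on $\Theta$; and $\mu_\theta(\{\omega:\alpha(\omega)=\theta\})=1$ for $\lambda$-almost every $\theta$. Then $\mu$ has a decomposition induced by $\mathcal D$, and every such decomposition $(\Theta,\lambda,(\mu_\theta))$ is weakly learnable: for $\lambda$-almost every $\theta$, for $\mu_\theta$-almost every $\omega=(\dots,a_{-1},a_0,a_1,\dots)$, one has $\mu(\zeta_0=a_0,\dots,\zeta_{n-1}=a_{n-1})>0$ for all $n$ and $$\lim_{N\to\infty}\frac1N\sum_{n=0}^{N-1}\ \max_{a\in A}\bigl|\mu(\zeta_n=a\mid a_0,\dots,a_{n-1})-\mu_\theta(\zeta_n=a\mid a_0,\dots,a_{n-1})\bigr|=0,$$ where $\nu(\zeta_n=a\mid a_0,\dots,a_{n-1})$ is the $\nu$-probability of $\{\zeta_n=a\}$ conditional on $\{\zeta_0=a_0,\dots,\zeta_{n-1}=a_{n-1}\}$. -/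

import Mathlib

open MeasureTheory ProbabilityTheory Filter Topology

namespace Learning

section Sequences

variable {A : Type*}

/-- The left shift `T` on two-sided sequences, `(T ω) n = ω (n + 1)`. -/
def shift (ω : ℤ → A) : ℤ → A := fun n => ω (n + 1)

/-- The event that the outcomes at times `0, …, n - 1` are those of `ω`. -/
def history (n : ℕ) (ω : ℤ → A) : Set (ℤ → A) :=
  {η | ∀ k : ℕ, k < n → η (k : ℤ) = ω (k : ℤ)}

/-- The past σ-algebra `𝓕_{-∞}^0`, generated by the outcomes at times `-1, -2, …`. -/
abbrev past (A : Type*) [MeasurableSpace A] : MeasurableSpace (ℤ → A) :=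
  ⨆ (k : ℤ) (_ : k < 0), MeasurableSpace.comap (fun ω : ℤ → A => ω k) inferInstance

variable [MeasurableSpace A]

/-- Laws on two-sided sequences: measures on the product σ-algebra of `ℤ → A` (which is the Borel
σ-algebra when `A` is finite and discrete). -/
abbrev Law (A : Type*) [MeasurableSpace A] : Type _ := Measure (ℤ → A)

/-- A law on two-sided sequences is stationary if it is invariant under the shift. -/
def IsStationary (μ : Law A) : Prop :=
  Measure.map shift μ = μ

/-- `𝒟` is shift-invariant if for every Borel set `S`, `S ∈ 𝒟` if and only if `T(S) ∈ 𝒟`. -/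
def IsShiftInvariant (𝒟 : MeasurableSpace (ℤ → A)) : Prop :=
  ∀ S : Set (ℤ → A), MeasurableSet S →
    (MeasurableSet[𝒟] S ↔ MeasurableSet[𝒟] (shift '' S))

/-- `𝒟 ⊆ 𝒢` up to `μ`-null sets: every set of `𝒟` is `μ`-a.e. equal to a set of `𝒢`. -/
def IsContainedMod (μ : Law A) (𝒟 𝒢 : MeasurableSpace (ℤ → A)) : Prop :=
  ∀ S : Set (ℤ → A), MeasurableSet[𝒟] S →
    ∃ S' : Set (ℤ → A), MeasurableSet[𝒢] S' ∧ S =ᵐ[μ] S'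

/-- The `n`-period predictive distribution `μ(· | ω 0, …, ω (n - 1))`, as the vector of the
probabilities that it gives to the outcomes at time `n`. It is meaningful when
`μ (history n ω) ≠ 0`. -/
noncomputable def predictive (μ : Law A) (n : ℕ) (ω : ℤ → A) : A → ℝ :=
  fun a => (ProbabilityTheory.cond μ (history n ω)).real {η | η (n : ℤ) = a}

/-- Strong Cesàro convergence of a real sequence. -/
def StrongCesaroTendsto (u : ℕ → ℝ) (l : ℝ) : Prop :=
  Tendsto (fun N : ℕ => (1 / (N : ℝ)) * ∑ k ∈ Finset.range N, |u k - l|) atTop (𝓝 0)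

/-- The belief `ν` weakly merges to `μ`: for `μ`-almost every realization, all predictions of
`ν` along the realization are defined and the distance between the predictions of `ν` and
those of `μ` strongly Cesàro converges to `0`. (The norm of `A → ℝ` is the maximum norm.) -/
def WeaklyMerges [Fintype A] (ν μ : Law A) : Prop :=
  ∀ᵐ ω ∂μ, (∀ n : ℕ, ν (history n ω) ≠ 0) ∧
    StrongCesaroTendsto (fun n => ‖predictive ν n ω - predictive μ n ω‖) 0

end Sequences

section Decompositions

variable {Ω Θ : Type*} [MeasurableSpace Θ]

/-- `(Θ, lam, (κ θ))` is a decomposition of the probability measure `μ`. (The space `Θ` is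
required to be standard Borel.) -/
structure IsDecomposition [MeasurableSpace Ω] [StandardBorelSpace Θ] (μ : Measure Ω)
    (lam : Measure Θ) (κ : Θ → Measure Ω) : Prop where
  isProbabilityMeasure : IsProbabilityMeasure lam
  isProbabilityMeasure_fiber : ∀ θ, IsProbabilityMeasure (κ θ)
  measurable : ∀ S : Set Ω, MeasurableSet S → Measurable fun θ => κ θ S
  eq_lintegral : ∀ S : Set Ω, MeasurableSet S → μ S = ∫⁻ θ, κ θ S ∂lam

/-- `(Θ, lam)` with the map `α : Ω → Θ` is the quotient of `(Ω, μ)` with respect to the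
σ-algebra `𝒟`: `α` is measurable and carries `μ` to `lam`, and up to `μ`-null sets `α` generates
`𝒟`, i.e. `α` is a.e. equal to a `𝒟`-measurable map and every `𝒟`-measurable function `f` with
values in a standard Borel space lifts to a measurable `g` on `Θ` with `f = g ∘ α` a.e. -/
structure IsQuotient [StandardBorelSpace Θ] (𝒟 : MeasurableSpace Ω)
    {mΩ : MeasurableSpace Ω} (μ : Measure Ω) (lam : Measure Θ) (α : Ω → Θ) : Prop where
  measurable : Measurable[mΩ] α
  map_eq : Measure.map α μ = lam
  exists_measurable_ae_eq : ∃ α' : Ω → Θ, Measurable[𝒟] α' ∧ α =ᵐ[μ] α'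
  exists_lift : ∀ (Y : Type) [MeasurableSpace Y] [StandardBorelSpace Y] (f : Ω → Y),
    Measurable[𝒟] f → ∃ g : Θ → Y, Measurable g ∧ f =ᵐ[μ] g ∘ α

/-- `(Θ, lam, (κ θ))` is the decomposition of `μ` induced by `𝒟`: `(Θ, lam)` is the quotient of
`(Ω, μ)` with respect to `𝒟` through a map `α`, and the `κ θ` are the conditional distributions
of `μ` over `𝒟`, i.e. they decompose `μ` and almost every `κ θ` is carried by the fiber
`{α = θ}`. -/
def IsInducedDecomposition [StandardBorelSpace Θ] (𝒟 : MeasurableSpace Ω)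
    {mΩ : MeasurableSpace Ω} (μ : Measure Ω) (lam : Measure Θ) (κ : Θ → Measure Ω) : Prop :=
  ∃ α : Ω → Θ, IsQuotient 𝒟 μ lam α ∧ IsDecomposition μ lam κ ∧
    ∀ᵐ θ ∂lam, κ θ {ω | α ω = θ} = 1

/-- A decomposition `(Θ, lam, (κ θ))` of `μ` is weakly learnable if `μ` weakly merges to `κ θ`
for `lam`-almost every `θ`. -/
def IsWeaklyLearnable {A : Type*} [Fintype A] [MeasurableSpace A] (μ : Law A)
    (lam : Measure Θ) (κ : Θ → Law A) : Prop :=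
  ∀ᵐ θ ∂lam, WeaklyMerges μ (κ θ)

end Decompositions

end Learning

/-!
The outcome at time `n` is predicted from three increasing amounts of information: the outcomes
`ω 0, …, ω (n - 1)`; these outcomes together with `𝒟`; and these outcomes together with `𝒟` and the
whole past `ω (-1), ω (-2), …`. Let `q n`, `p n`, `r n` be the conditional probabilities that
`ω n = a`. The predictions of `μ` are the `q n`. Since `α` generates `𝒟` and `κ θ` is carried by the
fiber `{α = θ}`, the predictions of `κ (α ω)` along `ω` are the `p n`
(`predictive_fiber_ae_eq`, which rests on `cond_fiber_ae_eq_condExp`). So it has to be shown that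
`|q n - p n|` averages to `0` almost everywhere.

The extreme predictions merge (`ae_tendsto_average_abs_condExp_past_sub`): as `𝒟` lies in the past
up to null sets, it does not matter for `r n`, and by stationarity `q n` and `r n` are the
compositions with the `n`-th iterate of the shift of the conditional probabilities that `ω 0 = a`
given the last `n` outcomes and given the whole past. Their difference tends to `0` by Lévy's upward
theorem, and Maker's theorem (`ae_tendsto_average_comp_iterate`), a consequence of the maximal
ergodic theorem, shows that `|q n - r n|` averages to `0`.

The intermediate prediction is squeezed between the two by comparing quadratic losses
(`ae_tendsto_average_abs_condExp_sub`). With `e n` the indicator of `ω n = a`,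
`(e - q)² - (e - r)² = (p - q)² + (r - p)² + 2 (p - q) (e - p) + 2 (r - p) (e - r)`.
The left-hand side is at most `2 |q - r|` and the last two terms are bounded martingale
differences, which average to `0` by the strong law of large numbers
(`ae_tendsto_average_of_condExp_eq_zero`). Hence `(p - q)²` averages to `0`.

For the existence of a decomposition, `α` records the conditional probabilities given `𝒟` of the
sets of a countable generating `π`-system (`exists_measurable_generating`), and `κ` is the
conditional distribution of a point given `α`.
-/

namespace Learning

/-! ### The maximal ergodic inequality and Maker's theorem -/

section Maker

variable {Ω : Type*} {T : Ω → Ω} {f : Ω → ℝ}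

/-- The maximum over `0 ≤ k ≤ N` of the Birkhoff sums `∑ i < k, f (T^[i] x)`, defined by the
recursion `M₀ = 0`, `M_{N+1} = max 0 (f + M_N ∘ T)`. -/
def maxBirkhoffSum (T : Ω → Ω) (f : Ω → ℝ) : ℕ → Ω → ℝ
  | 0, _ => 0
  | N + 1, x => max 0 (f x + maxBirkhoffSum T f N (T x))

lemma maxBirkhoffSum_nonneg (N : ℕ) (x : Ω) : 0 ≤ maxBirkhoffSum T f N x := by
  cases N with
  | zero => exact le_rfl
  | succ N => exact le_max_left _ _

lemma maxBirkhoffSum_le_succ (N : ℕ) (x : Ω) :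
    maxBirkhoffSum T f N x ≤ maxBirkhoffSum T f (N + 1) x := by
  induction N generalizing x with
  | zero => exact maxBirkhoffSum_nonneg _ _
  | succ N ih => exact max_le_max_left _ (add_le_add_right (ih (T x)) _)

lemma birkhoffSum_le_maxBirkhoffSum (N : ℕ) (x : Ω) :
    birkhoffSum T f N x ≤ maxBirkhoffSum T f N x := by
  induction N generalizing x with
  | zero => simp [maxBirkhoffSum]
  | succ N ih =>
    rw [birkhoffSum_succ']
    exact le_max_of_le_right (add_le_add_right (ih (T x)) _)

/-- On the set where `M_N > 0`, one has `M_N ≤ f + M_N ∘ T`; off this set `M_N = 0`. -/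
lemma maxBirkhoffSum_le (N : ℕ) (x : Ω) :
    maxBirkhoffSum T f N x ≤
      {y | 0 < maxBirkhoffSum T f N y}.indicator f x + maxBirkhoffSum T f N (T x) := by
  by_cases hx : 0 < maxBirkhoffSum T f N x
  · rw [Set.indicator_of_mem (s := {y | 0 < maxBirkhoffSum T f N y}) hx]
    cases N with
    | zero => exact absurd hx (lt_irrefl _)
    | succ N =>
      have h : maxBirkhoffSum T f (N + 1) x = f x + maxBirkhoffSum T f N (T x) := by
        rcases max_choice 0 (f x + maxBirkhoffSum T f N (T x)) with h | h
        · exact absurd h hx.ne'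
        · exact h
      rw [h]
      exact add_le_add_right (maxBirkhoffSum_le_succ N (T x)) _
  · rw [Set.indicator_of_notMem (s := {y | 0 < maxBirkhoffSum T f N y}) hx, zero_add]
    exact (not_lt.1 hx).trans (maxBirkhoffSum_nonneg _ _)

variable [MeasurableSpace Ω] {μ : Measure Ω}

lemma integrable_maxBirkhoffSum (hT : MeasurePreserving T μ μ) (hf : Integrable f μ) (N : ℕ) :
    Integrable (maxBirkhoffSum T f N) μ := by
  induction N with
  | zero => exact integrable_zero _ _ _
  | succ N ih => exact (integrable_zero _ _ _).sup (hf.add (hT.integrable_comp_of_integrable ih))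

lemma measurable_maxBirkhoffSum (hT : Measurable T) (hf : Measurable f) (N : ℕ) :
    Measurable (maxBirkhoffSum T f N) := by
  induction N with
  | zero => exact measurable_const
  | succ N ih => exact measurable_const.max (hf.add (ih.comp hT))

/-- The **maximal ergodic theorem**, by Garsia's argument. -/
lemma setIntegral_maxBirkhoffSum_pos_nonneg (hT : MeasurePreserving T μ μ) (hfm : Measurable f)
    (hf : Integrable f μ) (N : ℕ) : 0 ≤ ∫ x in {x | 0 < maxBirkhoffSum T f N x}, f x ∂μ := by
  have hE : MeasurableSet {x | 0 < maxBirkhoffSum T f N x} :=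
    measurableSet_lt measurable_const (measurable_maxBirkhoffSum hT.measurable hfm N)
  have hM := integrable_maxBirkhoffSum hT hf N
  have hMT : Integrable (fun x => maxBirkhoffSum T f N (T x)) μ :=
    hT.integrable_comp_of_integrable hM
  have h := integral_mono hM ((hf.indicator hE).add hMT) (maxBirkhoffSum_le N)
  have h' : ∫ x, maxBirkhoffSum T f N (T x) ∂μ = ∫ x, maxBirkhoffSum T f N x ∂μ := by
    conv_rhs => rw [← hT.map_eq]
    exact (integral_map hT.aemeasurable (by rw [hT.map_eq]; exact hM.1)).symm
  simp only [Pi.add_apply] at h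
  rw [integral_add (hf.indicator hE) hMT, h', integral_indicator hE] at h
  linarith

/-- The weak-type `L¹` bound for the maximal function of the ergodic averages. -/
lemma measure_exists_lt_birkhoffSum_le [IsProbabilityMeasure μ] (hT : MeasurePreserving T μ μ)
    (hfm : Measurable f) (hf : Integrable f μ) (hf0 : ∀ x, 0 ≤ f x) {ε : ℝ} (hε : 0 < ε) :
    μ {x | ∃ N : ℕ, ε * N < birkhoffSum T f N x} ≤ ENNReal.ofReal ((∫ x, f x ∂μ) / ε) := by
  set h : Ω → ℝ := fun x => f x - ε with h_def
  have hhm : Measurable h := hfm.sub_const ε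
  have hh : Integrable h μ := hf.sub (integrable_const ε)
  have hsum : ∀ N x, birkhoffSum T h N x = birkhoffSum T f N x - ε * N := fun N x => by
    simp [birkhoffSum, h_def, mul_comm]
  have hsub : {x | ∃ N : ℕ, ε * N < birkhoffSum T f N x} ⊆
      ⋃ N, {x | 0 < maxBirkhoffSum T h N x} := by
    rintro x ⟨N, hN⟩
    refine Set.mem_iUnion.2 ⟨N, lt_of_lt_of_le ?_ (birkhoffSum_le_maxBirkhoffSum N x)⟩
    rw [hsum]
    linarith
  have hmono : Monotone fun N => {x | 0 < maxBirkhoffSum T h N x} :=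
    monotone_nat_of_le_succ fun N x hx => lt_of_lt_of_le hx (maxBirkhoffSum_le_succ N x)
  refine (measure_mono hsub).trans ?_
  rw [hmono.measure_iUnion]
  refine iSup_le fun N => ?_
  have hpos := setIntegral_maxBirkhoffSum_pos_nonneg hT hhm hh N
  rw [integral_sub hf.integrableOn (integrable_const ε).integrableOn, setIntegral_const,
    smul_eq_mul] at hpos
  have hle := setIntegral_le_integral (s := {x | 0 < maxBirkhoffSum T h N x}) hf (ae_of_all _ hf0)
  rw [← ofReal_measureReal]
  refine ENNReal.ofReal_le_ofReal ?_
  rw [le_div_iff₀ hε]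
  linarith

/-- **Maker's theorem**: if `g n → 0` almost everywhere, boundedly, then the averages of
`g n (T^[n] x)` tend to `0` almost everywhere. The tail suprema `⨆ k, g (k + m)` have integrals
tending to `0`, and the maximal inequality transfers this to their ergodic averages. -/
theorem ae_tendsto_average_comp_iterate [IsProbabilityMeasure μ] (hT : MeasurePreserving T μ μ)
    {g : ℕ → Ω → ℝ} (hgm : ∀ n, Measurable (g n)) (hg0 : ∀ n x, 0 ≤ g n x)
    (hg1 : ∀ n x, g n x ≤ 1) (hg : ∀ᵐ x ∂μ, Tendsto (fun n => g n x) atTop (𝓝 0)) :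
    ∀ᵐ x ∂μ, Tendsto (fun N : ℕ => (1 / (N : ℝ)) * ∑ n ∈ Finset.range N, g n (T^[n] x))
      atTop (𝓝 0) := by
  set G : ℕ → Ω → ℝ := fun m x => ⨆ k, g (k + m) x with G_def
  have hbdd : ∀ m x, BddAbove (Set.range fun k => g (k + m) x) := fun m x =>
    ⟨1, by rintro _ ⟨k, rfl⟩; exact hg1 _ _⟩
  have hGm : ∀ m, Measurable (G m) := fun m => Measurable.iSup fun k => hgm (k + m)
  have hle : ∀ m n x, m ≤ n → g n x ≤ G m x := fun m n x hmn => by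
    have := le_ciSup (hbdd m x) (n - m)
    simpa [Nat.sub_add_cancel hmn] using this
  have hG0 : ∀ m x, 0 ≤ G m x := fun m x => (hg0 m x).trans (hle m m x le_rfl)
  have hG1 : ∀ m x, G m x ≤ 1 := fun m x => ciSup_le fun k => hg1 _ _
  have hGi : ∀ m, Integrable (G m) μ := fun m =>
    Integrable.of_bound (hGm m).aestronglyMeasurable 1
      (ae_of_all _ fun x => by rw [Real.norm_of_nonneg (hG0 m x)]; exact hG1 m x)
  have hGlim : ∀ᵐ x ∂μ, Tendsto (fun m => G m x) atTop (𝓝 0) := by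
    filter_upwards [hg] with x hx
    rw [Metric.tendsto_atTop]
    intro ε hε
    obtain ⟨M, hM⟩ := (Metric.tendsto_atTop.1 hx) (ε / 2) (half_pos hε)
    refine ⟨M, fun m hm => ?_⟩
    rw [Real.dist_eq, sub_zero, abs_of_nonneg (hG0 m x)]
    refine lt_of_le_of_lt (ciSup_le fun k => ?_) (half_lt_self hε)
    have := hM (k + m) (by omega)
    rw [Real.dist_eq, sub_zero] at this
    exact (le_abs_self _).trans this.le
  have hint : Tendsto (fun m => ∫ x, G m x ∂μ) atTop (𝓝 0) := by
    have := tendsto_integral_of_dominated_convergence (μ := μ) (fun _ => (1 : ℝ))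
      (fun m => (hGm m).aestronglyMeasurable) (integrable_const 1)
      (fun m => ae_of_all _ fun x => by rw [Real.norm_of_nonneg (hG0 m x)]; exact hG1 m x) hGlim
    simpa using this
  -- For each `ε`, almost every point avoids one of the exceptional sets of the maximal inequality.
  have key : ∀ ε : ℝ, 0 < ε → ∀ᵐ x ∂μ, ∃ m, ∀ N : ℕ, birkhoffSum T (G m) N x ≤ ε * N := by
    intro ε hε
    have hnull : μ {x | ∀ m, ∃ N : ℕ, ε * N < birkhoffSum T (G m) N x} = 0 := by
      have hlim : Tendsto (fun m => ENNReal.ofReal ((∫ x, G m x ∂μ) / ε)) atTop (𝓝 0) := by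
        have := ENNReal.tendsto_ofReal (hint.div_const ε)
        simpa using this
      refine le_antisymm (ge_of_tendsto' hlim fun m => ?_) (zero_le)
      exact (measure_mono (Set.ofPred_subset_ofPred.2 fun x hx => hx m)).trans
        (measure_exists_lt_birkhoffSum_le hT (hGm m) (hGi m) (hG0 m) hε)
    refine (ae_iff.2 ?_)
    convert hnull using 3
    push Not
    rfl
  have key' : ∀ᵐ x ∂μ, ∀ j : ℕ, ∃ m, ∀ N : ℕ,
      birkhoffSum T (G m) N x ≤ (1 / ((j : ℝ) + 1)) * N :=
    ae_all_iff.2 fun j => key _ Nat.one_div_pos_of_nat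
  filter_upwards [key'] with x hx
  rw [Metric.tendsto_atTop]
  intro ε hε
  obtain ⟨j, hj⟩ := exists_nat_one_div_lt (half_pos hε)
  obtain ⟨m, hm⟩ := hx j
  obtain ⟨M, hM⟩ := exists_nat_gt (m / (ε / 2))
  refine ⟨M + 1, fun N hN => ?_⟩
  have hNpos : (0 : ℝ) < N := by exact_mod_cast (by omega : 0 < N)
  have hmN : (m : ℝ) < ε / 2 * N := by
    rw [div_lt_iff₀ (half_pos hε)] at hM
    have : (M : ℝ) ≤ N := by exact_mod_cast (by omega : M ≤ N)
    nlinarith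
  have hsum : ∑ n ∈ Finset.range N, g n (T^[n] x) ≤ m + birkhoffSum T (G m) N x := by
    -- The first `m` terms are at most `1`; the others are dominated by the tail supremum.
    calc ∑ n ∈ Finset.range N, g n (T^[n] x)
        ≤ ∑ n ∈ Finset.range N, ((if n < m then 1 else 0) + G m (T^[n] x)) := by
          refine Finset.sum_le_sum fun n _ => ?_
          split_ifs with h
          · exact (hg1 _ _).trans (le_add_of_nonneg_right (hG0 _ _))
          · rw [zero_add]
            exact hle m n _ (not_lt.1 h)
      _ ≤ m + birkhoffSum T (G m) N x := by
          rw [Finset.sum_add_distrib]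
          refine add_le_add_left ?_ _
          rw [Finset.sum_boole]
          have : ((Finset.range N).filter (· < m)).card ≤ (Finset.range m).card :=
            Finset.card_le_card fun n hn => by simpa using (Finset.mem_filter.1 hn).2
          rw [Finset.card_range] at this
          exact_mod_cast this
  have hnn : 0 ≤ ∑ n ∈ Finset.range N, g n (T^[n] x) := Finset.sum_nonneg fun n _ => hg0 _ _
  rw [Real.dist_eq, sub_zero, abs_of_nonneg (by positivity), one_div, inv_mul_lt_iff₀ hNpos]
  have := hm N
  nlinarith

end Maker

/-! ### Conditional expectations and null sets -/

section CondExp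

variable {Ω : Type*}

lemma eventuallyMeasurableSpace_mono {l : Filter Ω} [CountableInterFilter l]
    {m₁ m₂ : MeasurableSpace Ω} (hle : m₁ ≤ m₂) :
    eventuallyMeasurableSpace m₁ l ≤ eventuallyMeasurableSpace m₂ l :=
  fun _ ⟨t, ht, hst⟩ => ⟨t, hle t ht, hst⟩

/-- If `m'` is contained in `m` up to null sets, adjoining `m'` to `m` does not change conditional
expectations. -/
lemma condExp_sup_ae_eq {mΩ : MeasurableSpace Ω} {μ : Measure Ω} [IsFiniteMeasure μ]
    {m m' : MeasurableSpace Ω} (hm : m ≤ mΩ) (hm' : m' ≤ mΩ)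
    (h : m' ≤ eventuallyMeasurableSpace m (ae μ)) {f : Ω → ℝ} (hf : Integrable f μ) :
    μ[f | m' ⊔ m] =ᵐ[μ] μ[f | m] := by
  refine (ae_eq_condExp_of_forall_setIntegral_eq (sup_le hm' hm) hf
    (fun s _ _ => integrable_condExp.integrableOn) (fun s hs _ => ?_)
    (stronglyMeasurable_condExp.mono le_sup_right).aestronglyMeasurable).symm
  obtain ⟨t, ht, hst⟩ := (sup_le h le_eventuallyMeasurableSpace : m' ⊔ m ≤ _) s hs
  rw [setIntegral_congr_set hst, setIntegral_congr_set hst, setIntegral_condExp hm hf ht]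

/-- Conditional expectations given σ-algebras that agree up to null sets, joined with a third
one, agree. -/
lemma condExp_sup_congr {mΩ : MeasurableSpace Ω} {μ : Measure Ω} [IsFiniteMeasure μ]
    {m m' 𝒢 : MeasurableSpace Ω} (hm : m ≤ mΩ) (hm' : m' ≤ mΩ) (h𝒢 : 𝒢 ≤ mΩ)
    (h : m ≤ eventuallyMeasurableSpace m' (ae μ)) (h' : m' ≤ eventuallyMeasurableSpace m (ae μ))
    {f : Ω → ℝ} (hf : Integrable f μ) : μ[f | m ⊔ 𝒢] =ᵐ[μ] μ[f | m' ⊔ 𝒢] := by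
  -- Both sides are compared with the conditional expectation given `m ⊔ m' ⊔ 𝒢`.
  have h₁ := condExp_sup_ae_eq (m := m' ⊔ 𝒢) (m' := m) (sup_le hm' h𝒢) hm
    (h.trans (eventuallyMeasurableSpace_mono le_sup_left)) hf
  have h₂ := condExp_sup_ae_eq (m := m ⊔ 𝒢) (m' := m') (sup_le hm h𝒢) hm'
    (h'.trans (eventuallyMeasurableSpace_mono le_sup_left)) hf
  rw [sup_left_comm] at h₁
  exact h₂.symm.trans h₁

/-- Conditional expectation is equivariant under measure-preserving maps. -/
lemma condExp_comp_ae_eq {Ω' : Type*} {m : MeasurableSpace Ω'} {mΩ : MeasurableSpace Ω}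
    {mΩ' : MeasurableSpace Ω'} {μ : Measure Ω} [IsFiniteMeasure μ] {ν : Measure Ω'}
    [IsFiniteMeasure ν] {T : Ω → Ω'} (hT : MeasurePreserving T μ ν) (hm : m ≤ mΩ')
    {f : Ω' → ℝ} (hf : Integrable f ν) :
    μ[f ∘ T | m.comap T] =ᵐ[μ] ν[f | m] ∘ T := by
  have hint : ∀ {g : Ω' → ℝ} {t : Set Ω'}, Integrable g ν → MeasurableSet t →
      ∫ x in T ⁻¹' t, g (T x) ∂μ = ∫ y in t, g y ∂ν := fun {g t} hg ht => by
    rw [← hT.map_eq, setIntegral_map ht (by rw [hT.map_eq]; exact hg.1) hT.aemeasurable]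
  have hle : m.comap T ≤ mΩ := by
    rintro _ ⟨t, ht, rfl⟩
    exact hT.measurable (hm t ht)
  refine (ae_eq_condExp_of_forall_setIntegral_eq hle (hT.integrable_comp_of_integrable hf)
    (fun s _ _ => (hT.integrable_comp_of_integrable integrable_condExp).integrableOn) ?_
    ?_).symm
  · rintro _ ⟨t, ht, rfl⟩ -
    simp only [Function.comp_apply]
    rw [hint integrable_condExp (hm t ht), hint hf (hm t ht), setIntegral_condExp hm hf ht]
  · exact (stronglyMeasurable_condExp.comp_measurable
      (comap_measurable T)).aestronglyMeasurable

end CondExp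

/-! ### Conditional distributions carried by the fibers of a map -/

section Fiber

/-- The total probability formula over the values `w ∈ R` of a finitely valued map `π`. -/
lemma setLIntegral_cond_preimage_singleton {Ω W : Type*} [MeasurableSpace Ω] [MeasurableSpace W]
    [Finite W] [MeasurableSingletonClass W] (ν : Measure Ω) [IsFiniteMeasure ν] {π : Ω → W}
    (hπ : Measurable π) (R : Set W) (E : Set Ω) :
    ∫⁻ ω in π ⁻¹' R, cond ν (π ⁻¹' {π ω}) E ∂ν = ν (π ⁻¹' R ∩ E) := by
  have := Fintype.ofFinite W
  have hR : MeasurableSet R := R.toFinite.measurableSet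
  have hF : ∀ w, MeasurableSet (π ⁻¹' {w}) := fun w => hπ (measurableSet_singleton w)
  classical
  calc ∫⁻ ω in π ⁻¹' R, cond ν (π ⁻¹' {π ω}) E ∂ν
      = ∫⁻ w in R, cond ν (π ⁻¹' {w}) E ∂(ν.map π) :=
        (setLIntegral_map (f := fun w => cond ν (π ⁻¹' {w}) E) hR (measurable_of_finite _) hπ).symm
    _ = ∑ w, R.indicator (fun w => cond ν (π ⁻¹' {w}) E) w * ν.map π {w} := by
        rw [← lintegral_indicator hR, lintegral_fintype]
    _ = ∑ w, R.indicator (fun w => ν (π ⁻¹' {w} ∩ E)) w := by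
        refine Finset.sum_congr rfl fun w _ => ?_
        by_cases hw : w ∈ R
        · rw [Set.indicator_of_mem hw, Set.indicator_of_mem hw,
            Measure.map_apply hπ (measurableSet_singleton w), cond_mul_eq_inter (hF w)]
        · rw [Set.indicator_of_notMem hw, Set.indicator_of_notMem hw, zero_mul]
    _ = ∑ w ∈ R.toFinite.toFinset, (ν.restrict E) (π ⁻¹' {w}) := by
        simp_rw [Measure.restrict_apply (hF _)]
        rw [Finset.sum_indicator_eq_sum_filter]
        congr 1
        ext w
        simp
    _ = ν (π ⁻¹' R ∩ E) := by
        rw [sum_measure_preimage_singleton _ fun w _ => hF w, Measure.restrict_apply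
          (hπ (Finset.measurableSet _)), Set.Finite.coe_toFinset]

variable {Ω Θ W : Type*} {mΩ : MeasurableSpace Ω} [MeasurableSpace Θ] [MeasurableSpace W] [Finite W]
  [MeasurableSingletonClass W]

/-- Measurability of the conditional probabilities given the value of a finitely valued map,
jointly in the parameter and the value. -/
lemma measurable_cond_preimage_singleton (κ : Kernel Θ Ω) {π : Ω → W} (hπ : Measurable π)
    {E : Set Ω} (hE : MeasurableSet E) :
    Measurable fun p : Θ × W => cond (κ p.1) (π ⁻¹' {p.2}) E := by
  refine measurable_from_prod_countable_left fun w => ?_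
  have hF : MeasurableSet (π ⁻¹' {w}) := hπ (measurableSet_singleton w)
  simp only [cond_apply hF]
  exact (κ.measurable_coe hF).inv.mul (κ.measurable_coe (hF.inter hE))

/-- Here `m` may be any σ-algebra for which `(α, π)` is measurable, in particular the one generated
by this pair. -/
lemma measurable_cond_fiber {Ω' : Type*} {m mΩ' : MeasurableSpace Ω'} (κ : @Kernel Θ Ω' _ mΩ')
    {α : Ω' → Θ} {π : Ω' → W} (hπ : Measurable[mΩ'] π) {E : Set Ω'} (hE : MeasurableSet[mΩ'] E)
    (hαπ : Measurable[m] fun ω => (α ω, π ω)) :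
    Measurable[m] fun ω => cond (κ (α ω)) (π ⁻¹' {π ω}) E := by
  have := (measurable_cond_preimage_singleton κ hπ hE).comp hαπ
  simpa only [Function.comp_def] using this

/-- Suppose that `κ θ` decomposes `μ` and is carried by the fiber `{α = θ}`. Then the total
probability formula holds for the pair `(α, π)`, with conditioning on `π` under `κ (α ω)`. -/
lemma setLIntegral_cond_fiber {μ : Measure Ω} {lam : Measure Θ} (κ : Kernel Θ Ω)
    [IsMarkovKernel κ] (hμ : ∀ S, MeasurableSet S → μ S = ∫⁻ θ, κ θ S ∂lam)
    {α : Ω → Θ} (hα : Measurable α) (hfib : ∀ᵐ θ ∂lam, ∀ᵐ ω ∂(κ θ), α ω = θ)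
    {π : Ω → W} (hπ : Measurable π) {E : Set Ω} (hE : MeasurableSet E)
    {R : Set (Θ × W)} (hR : MeasurableSet R) :
    ∫⁻ ω in (fun ω => (α ω, π ω)) ⁻¹' R, cond (κ (α ω)) (π ⁻¹' {π ω}) E ∂μ =
      μ ((fun ω => (α ω, π ω)) ⁻¹' R ∩ E) := by
  have hbind : μ = lam.bind κ := by
    ext S hS
    rw [hμ S hS, Measure.bind_apply hS κ.aemeasurable]
  have hαπ : Measurable fun ω => (α ω, π ω) := hα.prodMk hπ
  have hh : Measurable fun ω => cond (κ (α ω)) (π ⁻¹' {π ω}) E :=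
    measurable_cond_fiber κ hπ hE hαπ
  have hs : MeasurableSet ((fun ω => (α ω, π ω)) ⁻¹' R) := hαπ hR
  rw [← lintegral_indicator hs, hμ _ (hs.inter hE), hbind,
    Measure.lintegral_bind κ.aemeasurable (hh.indicator hs).aemeasurable]
  refine lintegral_congr_ae ?_
  filter_upwards [hfib] with θ hθ
  -- On the fiber, `(α, π) ∈ R` is a condition on `π` alone.
  have hsθ : (fun ω => (α ω, π ω)) ⁻¹' R =ᵐ[κ θ] π ⁻¹' {w | (θ, w) ∈ R} := by
    filter_upwards [hθ] with ω hω
    exact congrArg (fun θ' => (θ', π ω) ∈ R) hω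
  rw [lintegral_indicator hs, setLIntegral_congr hsθ,
    measure_congr (hsθ.inter (ae_eq_refl E)), ← setLIntegral_cond_preimage_singleton (κ θ) hπ]
  refine lintegral_congr_ae (ae_restrict_of_ae ?_)
  filter_upwards [hθ] with ω hω
  rw [hω]

/-- Suppose that `κ θ` decomposes `μ` and is carried by the fiber `{α = θ}`. Then the elementary
conditional probability of `E` under `κ (α ω)`, given the value of a finitely valued map `π`, is a
version of the conditional probability of `E` given `α` and `π`. (Values of `π` that are null under
`κ θ`, where `cond` is the zero measure, do not matter.) -/
lemma cond_fiber_ae_eq_condExp {μ : Measure Ω} [IsProbabilityMeasure μ] {lam : Measure Θ}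
    (κ : Kernel Θ Ω) [IsMarkovKernel κ]
    (hμ : ∀ S, MeasurableSet S → μ S = ∫⁻ θ, κ θ S ∂lam)
    {α : Ω → Θ} (hα : Measurable α) (hfib : ∀ᵐ θ ∂lam, ∀ᵐ ω ∂(κ θ), α ω = θ)
    {π : Ω → W} (hπ : Measurable π) {E : Set Ω} (hE : MeasurableSet E) :
    (fun ω => (cond (κ (α ω)) (π ⁻¹' {π ω})).real E) =ᵐ[μ]
      μ[E.indicator (fun _ => (1 : ℝ)) |
        MeasurableSpace.comap α inferInstance ⊔ MeasurableSpace.comap π inferInstance] := by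
  rw [← MeasurableSpace.comap_prodMk α π]
  have hαπ : Measurable fun ω => (α ω, π ω) := hα.prodMk hπ
  have hh : Measurable fun ω => cond (κ (α ω)) (π ⁻¹' {π ω}) E :=
    measurable_cond_fiber κ hπ hE hαπ
  have hint : Integrable (fun ω => (cond (κ (α ω)) (π ⁻¹' {π ω})).real E) μ :=
    Integrable.of_bound hh.ennreal_toReal.aestronglyMeasurable 1
      (ae_of_all _ fun ω => by
        rw [Real.norm_of_nonneg measureReal_nonneg]
        exact measureReal_le_one)
  refine ae_eq_condExp_of_forall_setIntegral_eq hαπ.comap_le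
    ((integrable_const (1 : ℝ)).indicator hE) (fun s _ _ => hint.integrableOn) ?_
    (measurable_cond_fiber κ hπ hE
      (comap_measurable _)).ennreal_toReal.stronglyMeasurable.aestronglyMeasurable
  rintro _ ⟨R, hR, rfl⟩ -
  simp only [measureReal_def]
  rw [integral_toReal hh.aemeasurable.restrict
    (ae_of_all _ fun ω => prob_le_one.trans_lt ENNReal.one_lt_top),
    setLIntegral_cond_fiber κ hμ hα hfib hπ hE hR, setIntegral_indicator hE,
    setIntegral_const, smul_eq_mul, mul_one, measureReal_def]

end Fiber

/-! ### Quotients and decompositions -/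

section Decomposition

variable {Ω Θ : Type*} [MeasurableSpace Θ] [StandardBorelSpace Θ]
  {𝒟 : MeasurableSpace Ω} {mΩ : MeasurableSpace Ω} {μ : Measure Ω} {lam : Measure Θ} {α : Ω → Θ}
  {κ : Θ → Measure Ω}

lemma IsQuotient.comap_le_eventuallyMeasurableSpace (hα : IsQuotient 𝒟 μ lam α) :
    MeasurableSpace.comap α inferInstance ≤ eventuallyMeasurableSpace 𝒟 (ae μ) := by
  obtain ⟨α', hα', hαα'⟩ := hα.exists_measurable_ae_eq
  rintro _ ⟨B, hB, rfl⟩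
  exact ⟨α' ⁻¹' B, hα' hB, hαα'.preimage B⟩

lemma IsQuotient.le_eventuallyMeasurableSpace_comap (hα : IsQuotient 𝒟 μ lam α) :
    𝒟 ≤ eventuallyMeasurableSpace (MeasurableSpace.comap α inferInstance) (ae μ) := by
  intro S hS
  obtain ⟨g, hg, hSg⟩ := hα.exists_lift Prop (fun ω => ω ∈ S)
    ((@measurableSet_setOfPred _ 𝒟 _).1 hS)
  exact ⟨α ⁻¹' {θ | g θ}, ⟨_, measurableSet_setOfPred.2 hg, rfl⟩, hSg⟩

/-- The members of a decomposition, as a Markov kernel. -/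
def IsDecomposition.kernel (h : IsDecomposition μ lam κ) : Kernel Θ Ω :=
  ⟨κ, Measure.measurable_of_measurable_coe κ h.measurable⟩

instance (h : IsDecomposition μ lam κ) : IsMarkovKernel h.kernel :=
  ⟨h.isProbabilityMeasure_fiber⟩

lemma IsDecomposition.eq_lintegral_kernel (h : IsDecomposition μ lam κ) (S : Set Ω)
    (hS : MeasurableSet S) : μ S = ∫⁻ θ, h.kernel θ S ∂lam :=
  h.eq_lintegral S hS

/-- A property that holds `μ`-almost everywhere holds almost everywhere for almost every member of
a decomposition of `μ`. -/
lemma IsDecomposition.ae_ae (h : IsDecomposition μ lam κ) {p : Ω → Prop} (hp : ∀ᵐ ω ∂μ, p ω) :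
    ∀ᵐ θ ∂lam, ∀ᵐ ω ∂(κ θ), p ω := by
  have hbind : μ = lam.bind h.kernel := by
    ext S hS
    rw [Measure.bind_apply hS h.kernel.aemeasurable]
    exact h.eq_lintegral_kernel S hS
  rw [hbind] at hp
  exact Measure.ae_ae_of_ae_comp hp

lemma IsDecomposition.ae_ae_eq (h : IsDecomposition μ lam κ) (hα : Measurable α)
    (hfib : ∀ᵐ θ ∂lam, κ θ {ω | α ω = θ} = 1) : ∀ᵐ θ ∂lam, ∀ᵐ ω ∂(κ θ), α ω = θ := by
  filter_upwards [hfib] with θ hθ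
  have := h.isProbabilityMeasure_fiber θ
  exact (prob_compl_eq_zero_iff (hα (measurableSet_singleton θ))).2 hθ

end Decomposition

/-! ### Existence of the induced decomposition -/

section Existence

variable {Ω Θ : Type*} [MeasurableSpace Θ]

/-- If `α` generates `𝒟` up to null sets, then every `𝒟`-measurable map into a standard Borel space
factors through `α` almost everywhere: it suffices to lift each of countably many binary
coordinates. -/
lemma exists_measurable_lift {mΩ : MeasurableSpace Ω} {μ : Measure Ω} [NeZero μ]
    {𝒟 : MeasurableSpace Ω} {α : Ω → Θ}
    (hα : 𝒟 ≤ eventuallyMeasurableSpace (MeasurableSpace.comap α inferInstance) (ae μ))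
    {Y : Type*} [MeasurableSpace Y] [StandardBorelSpace Y] {f : Ω → Y} (hf : Measurable[𝒟] f) :
    ∃ g : Θ → Y, Measurable g ∧ f =ᵐ[μ] g ∘ α := by
  have : Nonempty Ω := μ.nonempty_of_neZero
  have hY : Nonempty Y := this.map f
  obtain ⟨e, hem, hei⟩ := MeasurableSpace.measurable_injection_nat_bool_of_countablySeparated Y
  obtain ⟨r, hr, hre⟩ := (hem.measurableEmbedding hei).exists_measurable_extend measurable_id
    fun _ => hY
  have hB : ∀ n : ℕ, ∃ B : Set Θ, MeasurableSet B ∧ {ω | e (f ω) n = true} =ᵐ[μ] α ⁻¹' B := by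
    intro n
    have hS : MeasurableSet[𝒟] {ω | e (f ω) n = true} :=
      hf (((measurable_pi_apply n).comp hem) (measurableSet_singleton true))
    obtain ⟨_, ⟨B, hBm, rfl⟩, h⟩ := hα _ hS
    exact ⟨B, hBm, h⟩
  choose B hBm hB using hB
  classical
  refine ⟨r ∘ fun θ n => decide (θ ∈ B n), hr.comp (measurable_pi_iff.2 fun n => ?_), ?_⟩
  · refine measurable_to_bool ?_
    convert hBm n using 1
    ext θ
    simp
  · filter_upwards [ae_all_iff.2 hB] with ω hω
    have h : (fun n => decide (α ω ∈ B n)) = e (f ω) := by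
      funext n
      have := hω n
      rw [Bool.eq_iff_iff, decide_eq_true_iff]
      exact (iff_of_eq this).symm
    simp only [Function.comp_apply, h]
    exact (congrFun hre (f ω)).symm

/-- The conditional distribution of a point given `α` is carried by the fibers of `α`. -/
lemma condDistrib_id_fiber [StandardBorelSpace Θ] [MeasurableSpace Ω] [StandardBorelSpace Ω]
    [Nonempty Ω] {μ : Measure Ω} [IsFiniteMeasure μ] {α : Ω → Θ} (hα : Measurable α) :
    ∀ᵐ θ ∂(μ.map α), condDistrib id α μ θ {ω | α ω = θ} = 1 := by
  have hS : MeasurableSet {p : Θ × Ω | α p.2 = p.1} :=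
    measurableSet_eq_fun (hα.comp measurable_snd) measurable_fst
  have h : ∀ᵐ p ∂(μ.map α ⊗ₘ condDistrib id α μ), α p.2 = p.1 := by
    rw [compProd_map_condDistrib aemeasurable_id,
      ae_map_iff (hα.prodMk measurable_id).aemeasurable hS]
    exact ae_of_all _ fun _ => rfl
  filter_upwards [Measure.ae_ae_of_ae_compProd h] with θ hθ
  exact (prob_compl_eq_zero_iff (hα (measurableSet_singleton θ))).1 hθ

/-- A σ-algebra on a standard Borel probability space is generated, up to null sets, by a map into
a standard Borel space: the map which records the conditional probabilities, given `𝒟`, of a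
countable generating `π`-system. -/
lemma exists_measurable_generating {𝒟 : MeasurableSpace Ω} [mΩ : MeasurableSpace Ω]
    [StandardBorelSpace Ω] (μ : Measure Ω) [IsProbabilityMeasure μ] (h𝒟 : 𝒟 ≤ mΩ) :
    ∃ α : Ω → (Finset ℕ → ENNReal), Measurable[𝒟] α ∧
      𝒟 ≤ eventuallyMeasurableSpace (MeasurableSpace.comap α inferInstance) (ae μ) := by
  set t : Finset ℕ → Set Ω := fun F => ⋂ i ∈ F, MeasurableSpace.natGeneratingSequence Ω i
  have htm : ∀ F, MeasurableSet (t F) := fun F =>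
    F.measurableSet_biInter fun i _ => MeasurableSpace.measurableSet_natGeneratingSequence i
  have hgen : mΩ = MeasurableSpace.generateFrom (Set.range t) := by
    refine le_antisymm ?_ (MeasurableSpace.generateFrom_le ?_)
    · conv_lhs => rw [← MeasurableSpace.generateFrom_natGeneratingSequence Ω]
      refine MeasurableSpace.generateFrom_mono ?_
      rintro _ ⟨i, rfl⟩
      exact ⟨{i}, by simp [t]⟩
    · rintro _ ⟨F, rfl⟩
      exact htm F
  have hpi : IsPiSystem (Set.range t) := by
    rintro _ ⟨F, rfl⟩ _ ⟨F', rfl⟩ -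
    exact ⟨F ∪ F', by
      simp only [t, ← Finset.mem_coe, Finset.coe_union, Set.biInter_union]⟩
  set α : Ω → (Finset ℕ → ENNReal) := fun ω F => condExpKernel μ 𝒟 ω (t F)
  refine ⟨α, @measurable_pi_lambda _ _ _ 𝒟 _ _ fun F => measurable_condExpKernel (htm F), ?_⟩
  intro S hS
  have hker : Measurable[MeasurableSpace.comap α inferInstance]
      fun ω => (condExpKernel μ 𝒟 ω : Measure Ω) := by
    have hprob : ∀ ω, IsProbabilityMeasure (condExpKernel μ 𝒟 ω) :=
      (inferInstance : @IsMarkovKernel Ω Ω 𝒟 mΩ (condExpKernel μ 𝒟)).isProbabilityMeasure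
    refine @Measurable.measure_of_isPiSystem_of_isProbabilityMeasure _ _
      (MeasurableSpace.comap α inferInstance) mΩ _ hprob _ hgen hpi ?_
    rintro _ ⟨F, rfl⟩
    exact (measurable_pi_apply F).comp (comap_measurable α)
  refine ⟨{ω | condExpKernel μ 𝒟 ω S = 1}, ?_, ?_⟩
  · exact ((Measure.measurable_coe (h𝒟 S hS)).comp hker) (measurableSet_singleton 1)
  · have hcond : μ[S.indicator (fun _ => (1 : ℝ)) | 𝒟] = S.indicator (fun _ => (1 : ℝ)) :=
      condExp_of_stronglyMeasurable h𝒟 (stronglyMeasurable_const.indicator hS)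
        ((integrable_const _).indicator (h𝒟 S hS))
    have h := condExpKernel_ae_eq_condExp (μ := μ) h𝒟 (h𝒟 S hS)
    rw [hcond] at h
    filter_upwards [h] with ω hω
    refine propext ⟨fun hωS => ?_, fun hω1 => ?_⟩
    · rw [Set.indicator_of_mem hωS, measureReal_def, ENNReal.toReal_eq_one_iff] at hω
      exact hω
    · by_contra hωS
      have hω1 : condExpKernel μ 𝒟 ω S = 1 := hω1
      rw [Set.indicator_of_notMem hωS, measureReal_def, hω1] at hω
      simp at hω

theorem exists_isInducedDecomposition {𝒟 : MeasurableSpace Ω} [mΩ : MeasurableSpace Ω]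
    [StandardBorelSpace Ω] (μ : Measure Ω) [IsProbabilityMeasure μ] (h𝒟 : 𝒟 ≤ mΩ) :
    ∃ (Θ : Type) (_ : MeasurableSpace Θ) (_ : StandardBorelSpace Θ) (lam : Measure Θ)
      (κ : Θ → Measure Ω), IsInducedDecomposition 𝒟 μ lam κ := by
  have : Nonempty Ω := μ.nonempty_of_neZero
  obtain ⟨α, hα𝒟, hgen⟩ := exists_measurable_generating μ h𝒟
  have hα : Measurable α := hα𝒟.mono h𝒟 le_rfl
  refine ⟨_, inferInstance, inferInstance, μ.map α, fun θ => condDistrib id α μ θ, α,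
    ⟨hα, rfl, ⟨α, hα𝒟, ae_eq_refl _⟩, fun Y _ _ f hf => exists_measurable_lift hgen hf⟩,
    ⟨Measure.isProbabilityMeasure_map hα.aemeasurable, fun θ => inferInstance,
      fun S hS => Kernel.measurable_coe _ hS, fun S hS => ?_⟩, condDistrib_id_fiber hα⟩
  conv_lhs => rw [← Measure.map_id (μ := μ), ← condDistrib_comp_map hα.aemeasurable aemeasurable_id]
  exact Measure.bind_apply hS (Kernel.aemeasurable _)

end Existence

/-! ### Averages of bounded martingale differences -/

section Martingale

variable {Ω : Type*} {mΩ : MeasurableSpace Ω} {μ : Measure Ω} [IsProbabilityMeasure μ]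
  {ℋ : Filtration ℕ mΩ} {X : ℕ → Ω → ℝ}

lemma stronglyMeasurable_sum_range (hX : ∀ n, StronglyMeasurable[ℋ (n + 1)] (X n)) (N : ℕ) :
    StronglyMeasurable[ℋ N] fun ω => ∑ n ∈ Finset.range N, X n ω :=
  Finset.stronglyMeasurable_fun_sum _ fun n hn =>
    (hX n).mono (ℋ.mono (Finset.mem_range.1 hn))

lemma abs_sum_range_le {x : ℕ → ℝ} (hx : ∀ n, |x n| ≤ 1) (N : ℕ) :
    |∑ n ∈ Finset.range N, x n| ≤ N :=
  (Finset.abs_sum_le_sum_abs _ _).trans ((Finset.sum_le_sum fun n _ => hx n).trans (by simp))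

/-- Martingale differences are orthogonal, so the second moments of their sums grow linearly. -/
lemma integral_sq_sum_le (hX : ∀ n, StronglyMeasurable[ℋ (n + 1)] (X n))
    (hX1 : ∀ n, ∀ᵐ ω ∂μ, |X n ω| ≤ 1) (hX0 : ∀ n, μ[X n | ℋ n] =ᵐ[μ] 0) (N : ℕ) :
    ∫ ω, (∑ n ∈ Finset.range N, X n ω) ^ 2 ∂μ ≤ N := by
  have hXm : ∀ n, StronglyMeasurable (X n) := fun n => (hX n).mono (ℋ.le _)
  have hXi : ∀ n, Integrable (X n) μ := fun n =>
    Integrable.of_bound (hXm n).aestronglyMeasurable 1 (hX1 n)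
  induction N with
  | zero => simp
  | succ N ih =>
    have hS := stronglyMeasurable_sum_range hX N
    have hSm : StronglyMeasurable fun ω => ∑ n ∈ Finset.range N, X n ω := hS.mono (ℋ.le _)
    have hSb : ∀ᵐ ω ∂μ, |∑ n ∈ Finset.range N, X n ω| ≤ N := by
      filter_upwards [ae_all_iff.2 hX1] with ω hω
      exact abs_sum_range_le hω N
    have hS2 : Integrable (fun ω => (∑ n ∈ Finset.range N, X n ω) ^ 2) μ := by
      refine Integrable.of_bound (hSm.pow 2).aestronglyMeasurable ((N : ℝ) ^ 2) ?_
      filter_upwards [hSb] with ω hω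
      rw [norm_pow]
      exact pow_le_pow_left₀ (norm_nonneg _) hω 2
    have hSX : Integrable (fun ω => (∑ n ∈ Finset.range N, X n ω) * X N ω) μ :=
      (hXi N).bdd_mul hSm.aestronglyMeasurable hSb
    have hX2 : Integrable (fun ω => X N ω ^ 2) μ := by
      refine Integrable.of_bound ((hXm N).pow 2).aestronglyMeasurable 1 ?_
      filter_upwards [hX1 N] with ω hω
      rw [norm_pow]
      exact pow_le_one₀ (norm_nonneg _) hω
    have hcross : ∫ ω, (∑ n ∈ Finset.range N, X n ω) * X N ω ∂μ = 0 := by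
      have h := condExp_mul_of_stronglyMeasurable_left hS hSX (hXi N)
      rw [← integral_condExp (ℋ.le N)]
      refine (integral_congr_ae ?_).trans (integral_zero _ _)
      filter_upwards [h, hX0 N] with ω hω h0
      exact hω.trans (by simp [h0])
    have hX2le : ∫ ω, X N ω ^ 2 ∂μ ≤ 1 := by
      refine (integral_mono_ae hX2 (integrable_const 1) ?_).trans (by simp)
      filter_upwards [hX1 N] with ω hω
      exact (sq_le_one_iff_abs_le_one _).2 hω
    calc ∫ ω, (∑ n ∈ Finset.range (N + 1), X n ω) ^ 2 ∂μ
        = ∫ ω, ((∑ n ∈ Finset.range N, X n ω) ^ 2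
            + 2 * ((∑ n ∈ Finset.range N, X n ω) * X N ω) + X N ω ^ 2) ∂μ := by
          simp only [Finset.sum_range_succ]
          congr 1
          funext ω
          ring
      _ = ∫ ω, (∑ n ∈ Finset.range N, X n ω) ^ 2 ∂μ + ∫ ω, X N ω ^ 2 ∂μ := by
          have hadd : Integrable (fun ω => (∑ n ∈ Finset.range N, X n ω) ^ 2
              + 2 * ((∑ n ∈ Finset.range N, X n ω) * X N ω)) μ := hS2.add (hSX.const_mul 2)
          rw [integral_add hadd hX2, integral_add hS2 (hSX.const_mul 2),
            integral_const_mul, hcross, mul_zero, add_zero]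
      _ ≤ ((N + 1 : ℕ) : ℝ) := by
          push_cast
          linarith

/-- If the averages of a bounded sequence tend to `0` along the squares, they tend to `0`. -/
lemma tendsto_average_of_tendsto_sq {x : ℕ → ℝ} (hx : ∀ n, |x n| ≤ 1)
    (h : Tendsto (fun k : ℕ => (∑ n ∈ Finset.range (k ^ 2), x n) / (k : ℝ) ^ 2) atTop (𝓝 0)) :
    Tendsto (fun N : ℕ => (1 / (N : ℝ)) * ∑ n ∈ Finset.range N, x n) atTop (𝓝 0) := by
  have hsqrt : Tendsto Nat.sqrt atTop atTop :=
    tendsto_atTop_atTop.2 fun b => ⟨b ^ 2, fun N hN => Nat.le_sqrt'.2 hN⟩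
  have hlim : Tendsto (fun k : ℕ => |(∑ n ∈ Finset.range (k ^ 2), x n) / (k : ℝ) ^ 2| + 2 / (k : ℝ))
      atTop (𝓝 0) := by
    have := h.abs.add (tendsto_const_div_atTop_nhds_zero_nat (2 : ℝ))
    simpa using this
  refine squeeze_zero_norm' ?_ (hlim.comp hsqrt)
  filter_upwards [eventually_ge_atTop 1] with N hN
  set k := Nat.sqrt N with hk
  have hk1 : 1 ≤ k := Nat.le_sqrt'.2 (by simpa using hN)
  have hkN : k ^ 2 ≤ N := Nat.sqrt_le' N
  have hNk : N ≤ k ^ 2 + 2 * k := by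
    have := Nat.sqrt_le_add N
    rw [← hk] at this
    nlinarith
  have hk0 : (0 : ℝ) < k := by exact_mod_cast hk1
  have hkN' : (k : ℝ) ^ 2 ≤ N := by exact_mod_cast hkN
  have hsplit : |∑ n ∈ Finset.range N, x n| ≤ |∑ n ∈ Finset.range (k ^ 2), x n| + 2 * k := by
    rw [← Finset.sum_range_add_sum_Ico _ hkN]
    refine (abs_add_le _ _).trans (add_le_add_right ?_ _)
    refine (Finset.abs_sum_le_sum_abs _ _).trans ((Finset.sum_le_sum fun n _ => hx n).trans ?_)
    rw [Finset.sum_const, Nat.card_Ico, nsmul_eq_mul, mul_one]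
    exact_mod_cast (by omega : N - k ^ 2 ≤ 2 * k)
  calc ‖1 / (N : ℝ) * ∑ n ∈ Finset.range N, x n‖
      = |∑ n ∈ Finset.range N, x n| / N := by
        rw [Real.norm_eq_abs, abs_mul, abs_of_nonneg (by positivity)]
        ring
    _ ≤ (|∑ n ∈ Finset.range (k ^ 2), x n| + 2 * k) / (k : ℝ) ^ 2 :=
        div_le_div₀ (by positivity) hsplit (by positivity) hkN'
    _ = |(∑ n ∈ Finset.range (k ^ 2), x n) / (k : ℝ) ^ 2| + 2 / (k : ℝ) := by
        rw [abs_div, abs_of_nonneg (by positivity : (0 : ℝ) ≤ (k : ℝ) ^ 2)]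
        field_simp

/-- The strong law of large numbers for bounded martingale differences. The second moment bound
makes the squared averages along the squares summable. -/
theorem ae_tendsto_average_of_condExp_eq_zero
    (hX : ∀ n, StronglyMeasurable[ℋ (n + 1)] (X n))
    (hX1 : ∀ n, ∀ᵐ ω ∂μ, |X n ω| ≤ 1) (hX0 : ∀ n, μ[X n | ℋ n] =ᵐ[μ] 0) :
    ∀ᵐ ω ∂μ, Tendsto (fun N : ℕ => (1 / (N : ℝ)) * ∑ n ∈ Finset.range N, X n ω) atTop (𝓝 0) := by
  set Y : ℕ → Ω → ℝ := fun k ω => (∑ n ∈ Finset.range (k ^ 2), X n ω) / (k : ℝ) ^ 2 with hY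
  have hSm : ∀ N, StronglyMeasurable fun ω => ∑ n ∈ Finset.range N, X n ω := fun N =>
    (stronglyMeasurable_sum_range hX N).mono (ℋ.le _)
  have hYm : ∀ k, Measurable (Y k) := fun k => (hSm _).measurable.div_const _
  have hS2 : ∀ N, Integrable (fun ω => (∑ n ∈ Finset.range N, X n ω) ^ 2) μ := fun N => by
    refine Integrable.of_bound ((hSm N).pow 2).aestronglyMeasurable ((N : ℝ) ^ 2) ?_
    filter_upwards [ae_all_iff.2 hX1] with ω hω
    rw [norm_pow]
    exact pow_le_pow_left₀ (norm_nonneg _) (abs_sum_range_le hω N) 2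
  have hYint : ∀ k, ∫⁻ ω, ENNReal.ofReal (Y k ω ^ 2) ∂μ ≤ ENNReal.ofReal (1 / (k : ℝ) ^ 2) := by
    intro k
    have hYi : Integrable (fun ω => Y k ω ^ 2) μ := by
      simp only [hY, div_pow]
      exact (hS2 _).div_const _
    rw [← ofReal_integral_eq_lintegral_ofReal hYi (ae_of_all _ fun ω => sq_nonneg _)]
    refine ENNReal.ofReal_le_ofReal ?_
    simp only [hY, div_pow]
    rw [integral_div]
    refine (div_le_div_of_nonneg_right (integral_sq_sum_le hX hX1 hX0 (k ^ 2))
      (by positivity)).trans (le_of_eq ?_)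
    rcases eq_or_ne k 0 with rfl | hk
    · simp
    · have : (k : ℝ) ≠ 0 := by exact_mod_cast hk
      push_cast
      field_simp
  have htsum : ∫⁻ ω, ∑' k, ENNReal.ofReal (Y k ω ^ 2) ∂μ ≠ ⊤ := by
    rw [lintegral_tsum fun k => ((hYm k).pow_const 2).ennreal_ofReal.aemeasurable]
    refine ne_top_of_le_ne_top ?_ (ENNReal.tsum_le_tsum hYint)
    exact (Real.summable_one_div_nat_pow.2 one_lt_two).tsum_ofReal_ne_top
  have hfin := ae_lt_top' (AEMeasurable.tsum fun k =>
    ((hYm k).pow_const 2).ennreal_ofReal.aemeasurable) htsum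
  filter_upwards [hfin, ae_all_iff.2 hX1] with ω hω hω1
  refine tendsto_average_of_tendsto_sq hω1 ?_
  have h0 := ENNReal.tendsto_atTop_zero_of_tsum_ne_top hω.ne
  have h1 : Tendsto (fun k => Y k ω ^ 2) atTop (𝓝 0) := by
    have := (ENNReal.tendsto_toReal ENNReal.zero_ne_top).comp h0
    simpa [Function.comp_def, ENNReal.toReal_ofReal (sq_nonneg _)] using this
  have h2 : Tendsto (fun k => |Y k ω|) atTop (𝓝 0) := by
    have := h1.sqrt
    simpa [Real.sqrt_sq_eq_abs] using this
  exact (tendsto_zero_iff_abs_tendsto_zero _).2 h2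

lemma condExp_mem_Icc {m : MeasurableSpace Ω} (hm : m ≤ mΩ) {e : Ω → ℝ}
    (hei : Integrable e μ) (he : ∀ ω, e ω ∈ Set.Icc (0 : ℝ) 1) :
    ∀ᵐ ω ∂μ, (μ[e | m]) ω ∈ Set.Icc (0 : ℝ) 1 := by
  have h1 := condExp_mono (m := m) hei (integrable_const (1 : ℝ)) (ae_of_all μ fun ω => (he ω).2)
  rw [condExp_const hm] at h1
  filter_upwards [condExp_nonneg (m := m) (ae_of_all μ fun ω => (he ω).1), h1] with ω h0 h1
  exact ⟨h0, h1⟩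

/-- The prediction errors `e n - μ[e n | ℋ n]`, multiplied by bounded predictable factors `c n`,
average to `0`. -/
lemma ae_tendsto_average_mul_sub_condExp {e c : ℕ → Ω → ℝ}
    (he : ∀ n, StronglyMeasurable[ℋ (n + 1)] (e n)) (he1 : ∀ n ω, e n ω ∈ Set.Icc (0 : ℝ) 1)
    (hc : ∀ n, StronglyMeasurable[ℋ n] (c n)) (hc1 : ∀ n, ∀ᵐ ω ∂μ, |c n ω| ≤ 1) :
    ∀ᵐ ω ∂μ, Tendsto (fun N : ℕ => (1 / (N : ℝ)) *
      ∑ n ∈ Finset.range N, c n ω * (e n ω - (μ[e n | ℋ n]) ω)) atTop (𝓝 0) := by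
  have hei : ∀ n, Integrable (e n) μ := fun n =>
    Integrable.of_bound ((he n).mono (ℋ.le _)).aestronglyMeasurable 1
      (ae_of_all _ fun ω => by
        rw [Real.norm_of_nonneg (he1 n ω).1]
        exact (he1 n ω).2)
  refine ae_tendsto_average_of_condExp_eq_zero (ℋ := ℋ) (fun n => ?_) (fun n => ?_) fun n => ?_
  · exact ((hc n).mono (ℋ.mono n.le_succ)).mul
      ((he n).sub (stronglyMeasurable_condExp.mono (ℋ.mono n.le_succ)))
  · filter_upwards [hc1 n, condExp_mem_Icc (ℋ.le n) (hei n) (he1 n)] with ω h₁ h₂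
    rw [abs_mul]
    refine mul_le_one₀ h₁ (abs_nonneg _) (abs_le.2 ⟨?_, ?_⟩)
    · linarith [(he1 n ω).1, h₂.2]
    · linarith [(he1 n ω).2, h₂.1]
  · have hdi : Integrable (e n - μ[e n | ℋ n]) μ := (hei n).sub integrable_condExp
    have hmul : Integrable (c n * (e n - μ[e n | ℋ n])) μ :=
      hdi.bdd_mul ((hc n).mono (ℋ.le n)).aestronglyMeasurable (hc1 n)
    have h₁ := condExp_mul_of_stronglyMeasurable_left (hc n) hmul hdi
    have h₂ := condExp_sub (hei n) (integrable_condExp (m := ℋ n) (f := e n)) (ℋ n)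
    rw [condExp_of_stronglyMeasurable (ℋ.le n) stronglyMeasurable_condExp integrable_condExp]
      at h₂
    filter_upwards [h₁, h₂] with ω h₁ h₂
    refine h₁.trans ?_
    rw [Pi.mul_apply, h₂, Pi.sub_apply, sub_self, mul_zero, Pi.zero_apply]

/-- If the averages of `x n ^ 2` tend to `0`, so do those of `|x n|`, by Cauchy-Schwarz. -/
lemma tendsto_average_abs_of_sq {x : ℕ → ℝ}
    (h : Tendsto (fun N : ℕ => (1 / (N : ℝ)) * ∑ n ∈ Finset.range N, x n ^ 2) atTop (𝓝 0)) :
    Tendsto (fun N : ℕ => (1 / (N : ℝ)) * ∑ n ∈ Finset.range N, |x n|) atTop (𝓝 0) := by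
  have hs := h.sqrt
  rw [Real.sqrt_zero] at hs
  refine squeeze_zero (fun N => by positivity) (fun N => ?_) hs
  refine Real.le_sqrt_of_sq_le ?_
  have hcs := sq_sum_le_card_mul_sum_sq (s := Finset.range N) (f := fun n => |x n|)
  simp only [sq_abs, Finset.card_range] at hcs
  rcases eq_or_ne N 0 with rfl | hN
  · simp
  have hN' : (0 : ℝ) < N := by exact_mod_cast Nat.pos_of_ne_zero hN
  rw [mul_pow, one_div, inv_pow, inv_mul_le_iff₀ (by positivity)]
  calc (∑ n ∈ Finset.range N, |x n|) ^ 2 ≤ N * ∑ n ∈ Finset.range N, x n ^ 2 := hcs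
    _ = (N : ℝ) ^ 2 * ((N : ℝ)⁻¹ * ∑ n ∈ Finset.range N, x n ^ 2) := by field_simp

/-- Let `𝒬 ≤ ℋ ≤ ℛ` be filtrations. If the predictions of a bounded sequence `e` given `𝒬` merge on
average with those given `ℛ`, then they merge on average with those given `ℋ`. With predictions
`q`, `p`, `r` given `𝒬`, `ℋ`, `ℛ`, the quadratic losses satisfy
`(e - q)² - (e - r)² = (p - q)² + (r - p)² + 2 (p - q) (e - p) + 2 (r - p) (e - r)`,
where the last two terms are martingale differences and hence average to `0`. -/
theorem ae_tendsto_average_abs_condExp_sub {𝒬 ℋ ℛ : Filtration ℕ mΩ} (h𝒬ℋ : ∀ n, 𝒬 n ≤ ℋ n)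
    (hℋℛ : ∀ n, ℋ n ≤ ℛ n) {e : ℕ → Ω → ℝ} (he : ∀ n, StronglyMeasurable[𝒬 (n + 1)] (e n))
    (he1 : ∀ n ω, e n ω ∈ Set.Icc (0 : ℝ) 1)
    (h : ∀ᵐ ω ∂μ, Tendsto (fun N : ℕ => (1 / (N : ℝ)) *
      ∑ n ∈ Finset.range N, |(μ[e n | 𝒬 n]) ω - (μ[e n | ℛ n]) ω|) atTop (𝓝 0)) :
    ∀ᵐ ω ∂μ, Tendsto (fun N : ℕ => (1 / (N : ℝ)) *
      ∑ n ∈ Finset.range N, |(μ[e n | 𝒬 n]) ω - (μ[e n | ℋ n]) ω|) atTop (𝓝 0) := by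
  have hei : ∀ n, Integrable (e n) μ := fun n =>
    Integrable.of_bound ((he n).mono (𝒬.le _)).aestronglyMeasurable 1
      (ae_of_all _ fun ω => by
        rw [Real.norm_of_nonneg (he1 n ω).1]
        exact (he1 n ω).2)
  have hI : ∀ (𝒢 : Filtration ℕ mΩ) n, ∀ᵐ ω ∂μ, (μ[e n | 𝒢 n]) ω ∈ Set.Icc (0 : ℝ) 1 :=
    fun 𝒢 n => condExp_mem_Icc (𝒢.le n) (hei n) (he1 n)
  have hdiff : ∀ (𝒢 𝒢' : Filtration ℕ mΩ) n,
      ∀ᵐ ω ∂μ, |(μ[e n | 𝒢 n]) ω - (μ[e n | 𝒢' n]) ω| ≤ 1 := fun 𝒢 𝒢' n => by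
    filter_upwards [hI 𝒢 n, hI 𝒢' n] with ω h₁ h₂
    rw [abs_le]
    constructor <;> linarith [h₁.1, h₁.2, h₂.1, h₂.2]
  have hM := ae_tendsto_average_mul_sub_condExp (μ := μ) (ℋ := ℋ)
    (c := fun n ω => (μ[e n | ℋ n]) ω - (μ[e n | 𝒬 n]) ω)
    (fun n => (he n).mono (h𝒬ℋ _)) he1
    (fun n => stronglyMeasurable_condExp.sub (stronglyMeasurable_condExp.mono (h𝒬ℋ n)))
    (hdiff ℋ 𝒬)
  have hM' := ae_tendsto_average_mul_sub_condExp (μ := μ) (ℋ := ℛ)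
    (c := fun n ω => (μ[e n | ℛ n]) ω - (μ[e n | ℋ n]) ω)
    (fun n => (he n).mono ((h𝒬ℋ _).trans (hℋℛ _))) he1
    (fun n => stronglyMeasurable_condExp.sub (stronglyMeasurable_condExp.mono (hℋℛ n)))
    (hdiff ℛ ℋ)
  filter_upwards [h, hM, hM', ae_all_iff.2 (hI 𝒬), ae_all_iff.2 (hI ℛ)] with ω hω hM hM' hq hr
  refine tendsto_average_abs_of_sq ?_
  have hlim := ((hω.const_mul 2).sub (hM.const_mul 2)).sub (hM'.const_mul 2)
  simp only [mul_zero, sub_zero] at hlim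
  refine squeeze_zero (fun N => ?_) (fun N => ?_) hlim
  · exact mul_nonneg (by positivity) (Finset.sum_nonneg fun n _ => sq_nonneg _)
  · have hN : (0 : ℝ) ≤ 1 / (N : ℝ) := by positivity
    refine le_of_le_of_eq (mul_le_mul_of_nonneg_left (Finset.sum_le_sum (g := fun n =>
      2 * |(μ[e n | 𝒬 n]) ω - (μ[e n | ℛ n]) ω|
      - 2 * (((μ[e n | ℋ n]) ω - (μ[e n | 𝒬 n]) ω) * (e n ω - (μ[e n | ℋ n]) ω))
      - 2 * (((μ[e n | ℛ n]) ω - (μ[e n | ℋ n]) ω) * (e n ω - (μ[e n | ℛ n]) ω)))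
      fun n _ => ?_) hN) ?_
    · obtain ⟨hq0, hq1⟩ := hq n
      obtain ⟨hr0, hr1⟩ := hr n
      obtain ⟨he0, he1⟩ := he1 n ω
      generalize (μ[e n | 𝒬 n]) ω = q at *
      generalize (μ[e n | ℋ n]) ω = p at *
      generalize (μ[e n | ℛ n]) ω = r at *
      generalize e n ω = x at *
      -- The difference of losses is `(r - q) (2 x - q - r)`, with second factor in `[-2, 2]`.
      have hloss : (x - q) ^ 2 - (x - r) ^ 2 ≤ 2 * |q - r| := by
        have h₁ : (x - q) ^ 2 - (x - r) ^ 2 = (r - q) * (2 * x - q - r) := by ring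
        rw [h₁]
        refine (le_abs_self _).trans ?_
        rw [abs_mul, abs_sub_comm r q, mul_comm]
        exact mul_le_mul_of_nonneg_right (abs_le.2 ⟨by linarith, by linarith⟩) (abs_nonneg _)
      nlinarith [sq_nonneg (r - p)]
    · simp only [Finset.sum_sub_distrib, ← Finset.mul_sum]
      ring

end Martingale

/-! ### The shift and finite histories -/

section Shift

variable {A : Type*}

/-- The left shift as a measurable equivalence; its inverse is the right shift. -/
def shiftEquiv (A : Type*) [MeasurableSpace A] : (ℤ → A) ≃ᵐ (ℤ → A) where
  toFun := shift
  invFun ω n := ω (n - 1)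
  left_inv ω := funext fun n => by simp [shift]
  right_inv ω := funext fun n => by simp [shift]
  measurable_toFun := measurable_pi_lambda _ fun n => measurable_pi_apply (n + 1)
  measurable_invFun := measurable_pi_lambda _ fun n => measurable_pi_apply (n - 1)

lemma shift_iterate_apply (n : ℕ) (ω : ℤ → A) (k : ℤ) : shift^[n] ω k = ω (k + n) := by
  induction n generalizing ω with
  | zero => simp
  | succ n ih =>
    rw [Function.iterate_succ_apply, ih, shift]
    push_cast
    ring_nf

/-- The first `n` outcomes `ω 0, …, ω (n - 1)`. -/
def initial (n : ℕ) (ω : ℤ → A) : Fin n → A := fun i => ω (i : ℤ)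

lemma history_eq_preimage (n : ℕ) (ω : ℤ → A) :
    history n ω = initial n ⁻¹' {initial n ω} := by
  ext η
  simp [history, initial, funext_iff, Fin.forall_iff]

variable [MeasurableSpace A]

lemma shiftEquiv_symm_iterate_apply (n : ℕ) (ω : ℤ → A) (k : ℤ) :
    (shiftEquiv A).symm^[n] ω k = ω (k - n) := by
  induction n generalizing ω with
  | zero => simp
  | succ n ih =>
    rw [Function.iterate_succ_apply, ih]
    change ω (k - n - 1) = _
    push_cast
    ring_nf

lemma shiftEquiv_symm_iterate_shift_iterate (n : ℕ) (ω : ℤ → A) :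
    (shiftEquiv A).symm^[n] (shift^[n] ω) = ω := by
  funext k
  rw [shiftEquiv_symm_iterate_apply, shift_iterate_apply, sub_add_cancel]

lemma IsStationary.measurePreserving {μ : Law A} (hμ : IsStationary μ) :
    MeasurePreserving shift μ μ :=
  ⟨(shiftEquiv A).measurable, hμ⟩

lemma comap_pi_le_iff {Ω ι : Type*} {m : MeasurableSpace Ω} {X : Ω → ι → A} :
    MeasurableSpace.comap X MeasurableSpace.pi ≤ m ↔ ∀ i, Measurable[m] fun ω => X ω i :=
  measurable_iff_comap_le.symm.trans measurable_pi_iff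

lemma measurable_comp_comap {Ω Ω' β : Type*} {m : MeasurableSpace Ω'} [MeasurableSpace β]
    {f : Ω' → β} (hf : Measurable[m] f) (T : Ω → Ω') : Measurable[m.comap T] (f ∘ T) :=
  hf.comp (comap_measurable T)

lemma measurable_initial (n : ℕ) : Measurable (initial n : (ℤ → A) → Fin n → A) :=
  measurable_pi_lambda _ fun i => measurable_pi_apply (i : ℤ)

/-- The σ-algebra generated by the outcomes at times `-n, …, -1`. -/
abbrev recentPast (A : Type*) [MeasurableSpace A] (n : ℕ) : MeasurableSpace (ℤ → A) :=
  MeasurableSpace.comap (fun ω => initial n ((shiftEquiv A).symm^[n] ω)) inferInstance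

lemma comap_recentPast (n : ℕ) : (recentPast A n).comap shift^[n] =
    MeasurableSpace.comap (initial n) inferInstance := by
  rw [MeasurableSpace.comap_comp]
  congr 1
  funext ω
  exact congrArg _ (shiftEquiv_symm_iterate_shift_iterate n ω)

lemma measurable_eval_recentPast {n : ℕ} {k : ℤ} (hk : k < 0) (hn : -(n : ℤ) ≤ k) :
    Measurable[recentPast A n] fun ω : ℤ → A => ω k := by
  have hi : (k + n).toNat < n := by omega
  have h : (fun ω : ℤ → A => ω k) =
      fun ω => initial n ((shiftEquiv A).symm^[n] ω) ⟨(k + n).toNat, hi⟩ := by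
    funext ω
    rw [initial, shiftEquiv_symm_iterate_apply]
    congr 1
    simp only
    omega
  rw [h]
  exact comap_pi_le_iff.1 le_rfl _

lemma recentPast_le_iff {n : ℕ} {m : MeasurableSpace (ℤ → A)} :
    recentPast A n ≤ m ↔
      ∀ k : ℤ, k < 0 → -(n : ℤ) ≤ k → Measurable[m] fun ω : ℤ → A => ω k := by
  refine ⟨fun h k hk hn => (measurable_eval_recentPast hk hn).mono h le_rfl, fun h => ?_⟩
  refine Measurable.comap_le (measurable_pi_iff.2 fun i => ?_)
  simp only [initial, shiftEquiv_symm_iterate_apply]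
  exact h _ (by omega) (by omega)

lemma recentPast_mono : Monotone (recentPast A) := fun _ _ hmn =>
  recentPast_le_iff.2 fun _ hk hm => measurable_eval_recentPast hk (by omega)

lemma recentPast_le_pi (n : ℕ) : recentPast A n ≤ MeasurableSpace.pi :=
  recentPast_le_iff.2 fun k _ _ => measurable_pi_apply k

lemma past_le_pi : past A ≤ MeasurableSpace.pi :=
  iSup₂_le fun k _ => (measurable_pi_apply k).comap_le

lemma iSup_recentPast : ⨆ n, recentPast A n = past A := by
  refine le_antisymm (iSup_le fun n => recentPast_le_iff.2 fun k hk _ => ?_)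
    (iSup₂_le fun k hk => ?_)
  · exact (comap_measurable _).mono (le_iSup₂_of_le k hk le_rfl) le_rfl
  · exact (measurable_eval_recentPast (n := k.natAbs) hk (by omega)).comap_le.trans
      (le_iSup (recentPast A) _)

/-- Seen from time `n`, the past consists of the outcomes before time `0` and of the first `n`
outcomes since. -/
lemma comap_past_shift_iterate (n : ℕ) : (past A).comap shift^[n] =
    past A ⊔ MeasurableSpace.comap (initial n) inferInstance := by
  have hpast : ∀ k : ℤ, k < 0 → Measurable[past A] fun ω : ℤ → A => ω k := fun k hk =>
    (comap_measurable _).mono (le_iSup₂_of_le k hk le_rfl) le_rfl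
  have hshift : ∀ k : ℤ, k < n →
      Measurable[(past A).comap shift^[n]] fun ω : ℤ → A => ω k := fun k hk => by
    have h := measurable_comp_comap (hpast (k - n) (by omega)) shift^[n]
    simpa only [Function.comp_def, shift_iterate_apply, sub_add_cancel] using h
  refine le_antisymm ?_ (sup_le (iSup₂_le fun k hk => (hshift k (by omega)).comap_le)
    (comap_pi_le_iff.2 fun i => hshift i (by omega)))
  rw [MeasurableSpace.comap_iSup]
  refine iSup_le fun k => ?_
  rw [MeasurableSpace.comap_iSup]
  refine iSup_le fun hk => ?_
  rw [MeasurableSpace.comap_comp]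
  refine Measurable.comap_le ?_
  simp only [Function.comp_def, shift_iterate_apply]
  rcases lt_or_ge (k + n) 0 with h | h
  · exact (hpast _ h).mono le_sup_left le_rfl
  · have hi : (k + n).toNat < n := by omega
    have hm : Measurable[MeasurableSpace.comap (initial n) inferInstance]
        fun ω : ℤ → A => initial n ω ⟨(k + n).toNat, hi⟩ :=
      comap_pi_le_iff.1 le_rfl _
    have heq : (fun ω : ℤ → A => ω (k + n)) = fun ω => initial n ω ⟨(k + n).toNat, hi⟩ := by
      funext ω
      rw [initial]
      congr 1
      simp only
      omega
    rw [heq]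
    exact hm.mono le_sup_right le_rfl

/-- The filtration of the outcomes at times `0, …, n - 1`, enlarged by a fixed σ-algebra `𝒟`. -/
def historyFiltration (𝒟 : MeasurableSpace (ℤ → A)) (h𝒟 : 𝒟 ≤ MeasurableSpace.pi) :
    Filtration ℕ (MeasurableSpace.pi : MeasurableSpace (ℤ → A)) where
  seq n := 𝒟 ⊔ MeasurableSpace.comap (initial n) inferInstance
  mono' _ n hmn := sup_le_sup_left (comap_pi_le_iff.2 fun i =>
    comap_pi_le_iff.1 (le_refl (MeasurableSpace.comap (initial n) _)) (Fin.castLE hmn i)) 𝒟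
  le' n := sup_le h𝒟 (measurable_initial n).comap_le

lemma historyFiltration_apply (𝒟 : MeasurableSpace (ℤ → A)) (h𝒟 : 𝒟 ≤ MeasurableSpace.pi) (n : ℕ) :
    historyFiltration 𝒟 h𝒟 n = 𝒟 ⊔ MeasurableSpace.comap (initial n) inferInstance :=
  rfl

end Shift

/-! ### Weak learnability -/

section Learnability

/-- The indicator of the event that the outcome at time `k` is `a`. -/
noncomputable def outcomeIndicator {A : Type*} (k : ℤ) (a : A) : (ℤ → A) → ℝ :=
  {η | η k = a}.indicator fun _ => 1

lemma outcomeIndicator_mem_Icc {A : Type*} (k : ℤ) (a : A) (ω : ℤ → A) :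
    outcomeIndicator k a ω ∈ Set.Icc (0 : ℝ) 1 :=
  ⟨Set.indicator_nonneg (fun _ _ => zero_le_one) ω,
    Set.indicator_le_self' (fun _ _ => zero_le_one) ω⟩

lemma outcomeIndicator_comp_shift_iterate {A : Type*} (n : ℕ) (a : A) :
    outcomeIndicator 0 a ∘ shift^[n] = outcomeIndicator n a := by
  classical
  funext ω
  simp [outcomeIndicator, Set.indicator_apply, shift_iterate_apply]

variable {A : Type*} [MeasurableSpace A]

lemma ae_measure_history_ne_zero [Finite A] (μ : Law A) :
    ∀ᵐ ω ∂μ, ∀ n : ℕ, μ (history n ω) ≠ 0 := by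
  refine ae_all_iff.2 fun n => ?_
  have h : {ω | μ (history n ω) = 0} ⊆
      ⋃ w ∈ {w : Fin n → A | μ (initial n ⁻¹' {w}) = 0}, initial n ⁻¹' {w} := fun ω hω => by
    rw [Set.mem_ofPred_eq, history_eq_preimage] at hω
    exact Set.mem_biUnion (Set.mem_ofPred.2 hω) rfl
  rw [ae_iff]
  simp only [ne_eq, not_not]
  exact measure_mono_null h ((measure_biUnion_null_iff (Set.to_countable _)).2 fun w hw => hw)

variable [MeasurableSingletonClass A]

lemma measurableSet_eval_eq (k : ℤ) (a : A) : MeasurableSet {η : ℤ → A | η k = a} :=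
  (measurable_pi_apply k : Measurable fun η : ℤ → A => η k) (measurableSet_singleton a)

lemma integrable_outcomeIndicator (μ : Law A) [IsFiniteMeasure μ] (k : ℤ) (a : A) :
    Integrable (outcomeIndicator k a) μ :=
  (integrable_const (1 : ℝ)).indicator (measurableSet_eval_eq k a)

lemma stronglyMeasurable_outcomeIndicator (𝒟 : MeasurableSpace (ℤ → A))
    (h𝒟 : 𝒟 ≤ MeasurableSpace.pi) (n : ℕ) (a : A) :
    StronglyMeasurable[historyFiltration 𝒟 h𝒟 (n + 1)] (outcomeIndicator (n : ℤ) a) := by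
  have hm : Measurable[historyFiltration 𝒟 h𝒟 (n + 1)] fun ω : ℤ → A => ω n :=
    (comap_pi_le_iff.1 (le_refl (MeasurableSpace.comap (initial (n + 1)) _)) (Fin.last n)).mono
      le_sup_right le_rfl
  exact stronglyMeasurable_const.indicator (hm (measurableSet_singleton a))

/-- Predictions from the outcomes since time `0` merge on average with predictions from the whole
past. After a shift of time `n` to time `0`, this is Lévy's upward theorem, and Maker's theorem
applies to the differences. -/
lemma ae_tendsto_average_abs_condExp_past_sub {μ : Law A} [IsProbabilityMeasure μ]
    (hμ : IsStationary μ) (a : A) :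
    ∀ᵐ ω ∂μ, Tendsto (fun N : ℕ => (1 / (N : ℝ)) * ∑ n ∈ Finset.range N,
      |(μ[outcomeIndicator n a | MeasurableSpace.comap (initial n) inferInstance]) ω -
        (μ[outcomeIndicator n a |
          past A ⊔ MeasurableSpace.comap (initial n) inferInstance]) ω|) atTop (𝓝 0) := by
  let ℱ : Filtration ℕ (MeasurableSpace.pi : MeasurableSpace (ℤ → A)) :=
    ⟨recentPast A, recentPast_mono, recentPast_le_pi⟩
  have hℱ : ⨆ n, ℱ n = past A := iSup_recentPast
  have hlevy := tendsto_ae_condExp (μ := μ) (ℱ := ℱ) (outcomeIndicator 0 a)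
  rw [hℱ] at hlevy
  have hi := integrable_outcomeIndicator μ 0 a
  -- The differences are at most `1` almost everywhere; truncation gives bounded versions.
  set g : ℕ → (ℤ → A) → ℝ := fun n ω => min 1
    |(μ[outcomeIndicator 0 a | recentPast A n]) ω - (μ[outcomeIndicator 0 a | past A]) ω| with hg
  have hgm : ∀ n, Measurable (g n) := fun n => measurable_const.min
    (((stronglyMeasurable_condExp.mono (recentPast_le_pi n)).sub
      (stronglyMeasurable_condExp.mono past_le_pi)).measurable.abs)
  have hg0 : ∀ᵐ ω ∂μ, Tendsto (fun n => g n ω) atTop (𝓝 0) := by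
    filter_upwards [hlevy] with ω hω
    have := (tendsto_const_nhds (x := (1 : ℝ))).min
      (hω.sub_const ((μ[outcomeIndicator 0 a | past A]) ω)).abs
    simpa using this
  have hmaker := ae_tendsto_average_comp_iterate hμ.measurePreserving hgm
    (fun n ω => le_min zero_le_one (abs_nonneg _)) (fun n ω => min_le_left _ _) hg0
  have hgn : ∀ n : ℕ, ∀ᵐ ω ∂μ, g n (shift^[n] ω) =
      |(μ[outcomeIndicator n a | MeasurableSpace.comap (initial n) inferInstance]) ω -
        (μ[outcomeIndicator n a |
          past A ⊔ MeasurableSpace.comap (initial n) inferInstance]) ω| := by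
    intro n
    have hT : MeasurePreserving shift^[n] μ μ := hμ.measurePreserving.iterate n
    have h₁ := condExp_comp_ae_eq hT (recentPast_le_pi n) hi
    have h₂ := condExp_comp_ae_eq hT past_le_pi hi
    rw [comap_recentPast, outcomeIndicator_comp_shift_iterate] at h₁
    rw [comap_past_shift_iterate, outcomeIndicator_comp_shift_iterate] at h₂
    have hI₁ := condExp_mem_Icc (measurable_initial n).comap_le
      (integrable_outcomeIndicator μ n a) (outcomeIndicator_mem_Icc (n : ℤ) a)
    have hI₂ := condExp_mem_Icc (sup_le past_le_pi (measurable_initial n).comap_le)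
      (integrable_outcomeIndicator μ n a) (outcomeIndicator_mem_Icc (n : ℤ) a)
    filter_upwards [h₁, h₂, hI₁, hI₂] with ω h₁ h₂ hI₁ hI₂
    simp only [hg]
    rw [Function.comp_apply] at h₁ h₂
    rw [← h₁, ← h₂]
    exact min_eq_right (abs_le.2 ⟨by linarith [hI₁.1, hI₂.2], by linarith [hI₁.2, hI₂.1]⟩)
  filter_upwards [hmaker, ae_all_iff.2 hgn] with ω hω hω'
  simpa only [hω'] using hω

/-- Predictions from the outcomes since time `0` merge on average with predictions which use, in
addition, a σ-algebra contained in the past up to null sets. -/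
lemma ae_tendsto_average_abs_condExp_sub_of_le_past {μ : Law A} [IsProbabilityMeasure μ]
    (hμ : IsStationary μ) (a : A) {𝒟 : MeasurableSpace (ℤ → A)} (h𝒟 : 𝒟 ≤ MeasurableSpace.pi)
    (hpast : 𝒟 ≤ eventuallyMeasurableSpace (past A) (ae μ)) :
    ∀ᵐ ω ∂μ, Tendsto (fun N : ℕ => (1 / (N : ℝ)) * ∑ n ∈ Finset.range N,
      |(μ[outcomeIndicator n a | MeasurableSpace.comap (initial n) inferInstance]) ω -
        (μ[outcomeIndicator n a |
          𝒟 ⊔ MeasurableSpace.comap (initial n) inferInstance]) ω|) atTop (𝓝 0) := by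
  have hbot : ∀ n, historyFiltration (⊥ : MeasurableSpace (ℤ → A)) bot_le n =
      MeasurableSpace.comap (initial n) inferInstance := fun n => bot_sup_eq _
  -- Adjoining `𝒟` to the past changes conditional expectations on null sets only.
  have hcond : ∀ n : ℕ, μ[outcomeIndicator n a |
        historyFiltration (𝒟 ⊔ past A) (sup_le h𝒟 past_le_pi) n] =ᵐ[μ]
      μ[outcomeIndicator n a | past A ⊔ MeasurableSpace.comap (initial n) inferInstance] := by
    intro n
    rw [historyFiltration_apply, sup_assoc]
    refine condExp_sup_ae_eq (sup_le past_le_pi (measurable_initial n).comap_le) h𝒟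
      (hpast.trans ?_) (integrable_outcomeIndicator μ n a)
    exact eventuallyMeasurableSpace_mono le_sup_left
  have h := ae_tendsto_average_abs_condExp_sub (μ := μ)
    (𝒬 := historyFiltration (⊥ : MeasurableSpace (ℤ → A)) bot_le)
    (ℋ := historyFiltration 𝒟 h𝒟)
    (ℛ := historyFiltration (𝒟 ⊔ past A) (sup_le h𝒟 past_le_pi))
    (fun n => sup_le_sup_right bot_le _) (fun n => sup_le_sup_right le_sup_left _)
    (e := fun n => outcomeIndicator n a)
    (fun n => stronglyMeasurable_outcomeIndicator _ _ n a)
    (fun n ω => outcomeIndicator_mem_Icc _ a ω) (by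
      filter_upwards [ae_tendsto_average_abs_condExp_past_sub hμ a, ae_all_iff.2 hcond]
        with ω hω hω'
      simpa only [hω', hbot] using hω)
  simpa only [hbot, historyFiltration_apply] using h

variable [Fintype A]

/-- Along almost every realization, the predictions of `κ (α ω)` are the conditional probabilities
given `𝒟` and the outcomes so far, where `𝒟` is the σ-algebra generated by `α` up to null sets. -/
lemma predictive_fiber_ae_eq {Θ : Type*} [MeasurableSpace Θ] {μ : Law A} [IsProbabilityMeasure μ]
    {lam : Measure Θ} (κ : Kernel Θ (ℤ → A)) [IsMarkovKernel κ]
    (hκ : ∀ S, MeasurableSet S → μ S = ∫⁻ θ, κ θ S ∂lam)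
    {α : (ℤ → A) → Θ} (hα : Measurable α) (hfib : ∀ᵐ θ ∂lam, ∀ᵐ ω ∂(κ θ), α ω = θ)
    {𝒟 : MeasurableSpace (ℤ → A)} (h𝒟 : 𝒟 ≤ MeasurableSpace.pi)
    (hα𝒟 : MeasurableSpace.comap α inferInstance ≤ eventuallyMeasurableSpace 𝒟 (ae μ))
    (h𝒟α : 𝒟 ≤ eventuallyMeasurableSpace (MeasurableSpace.comap α inferInstance) (ae μ))
    (n : ℕ) (a : A) :
    (fun ω => predictive (κ (α ω)) n ω a) =ᵐ[μ]
      μ[outcomeIndicator n a | 𝒟 ⊔ MeasurableSpace.comap (initial n) inferInstance] := by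
  have h₁ := cond_fiber_ae_eq_condExp κ hκ hα hfib (measurable_initial n)
    (measurableSet_eval_eq (A := A) n a)
  have h₂ := condExp_sup_congr hα.comap_le h𝒟 (measurable_initial n).comap_le hα𝒟 h𝒟α
    (integrable_outcomeIndicator μ n a)
  simp only [predictive, history_eq_preimage]
  exact h₁.trans h₂

/-- The own predictions of `μ` are conditional probabilities given the outcomes so far: this is the
case of the trivial decomposition of `μ`. -/
lemma predictive_ae_eq (μ : Law A) [IsProbabilityMeasure μ] (n : ℕ) (a : A) :
    (fun ω => predictive μ n ω a) =ᵐ[μ]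
      μ[outcomeIndicator n a | MeasurableSpace.comap (initial n) inferInstance] := by
  have hbot : MeasurableSpace.comap (fun _ : ℤ → A => ()) inferInstance = ⊥ :=
    MeasurableSpace.comap_const ()
  have := predictive_fiber_ae_eq (μ := μ) (lam := Measure.dirac ()) (Kernel.const Unit μ) (by simp)
    (α := fun _ => ()) measurable_const (ae_of_all _ fun _ => ae_of_all _ fun _ => rfl)
    (𝒟 := ⊥) bot_le (by rw [hbot]; exact bot_le) bot_le n a
  simpa only [bot_sup_eq, Kernel.const_apply] using this

theorem isWeaklyLearnable_of_isInducedDecomposition {Θ : Type*} [MeasurableSpace Θ]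
    [StandardBorelSpace Θ] {μ : Law A} [IsProbabilityMeasure μ] (hμ : IsStationary μ)
    {lam : Measure Θ} {κ : Θ → Law A} {𝒟 : MeasurableSpace (ℤ → A)}
    (h𝒟 : 𝒟 ≤ MeasurableSpace.pi) (hpast : IsContainedMod μ 𝒟 (past A))
    (h : IsInducedDecomposition 𝒟 μ lam κ) : IsWeaklyLearnable μ lam κ := by
  obtain ⟨α, hα, hκ, hfib⟩ := h
  have hfib' := hκ.ae_ae_eq hα.measurable hfib
  have hfiber : ∀ (n : ℕ) (a : A), (fun ω => predictive (κ (α ω)) n ω a) =ᵐ[μ]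
      μ[outcomeIndicator n a | 𝒟 ⊔ MeasurableSpace.comap (initial n) inferInstance] :=
    predictive_fiber_ae_eq hκ.kernel hκ.eq_lintegral_kernel hα.measurable hfib' h𝒟
      hα.comap_le_eventuallyMeasurableSpace hα.le_eventuallyMeasurableSpace_comap
  have hlim : ∀ᵐ ω ∂μ, Tendsto (fun N : ℕ => (1 / (N : ℝ)) * ∑ n ∈ Finset.range N,
      ‖predictive μ n ω - predictive (κ (α ω)) n ω‖) atTop (𝓝 0) := by
    filter_upwards [ae_all_iff.2 fun a =>
        ae_tendsto_average_abs_condExp_sub_of_le_past hμ a h𝒟 hpast,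
      ae_all_iff.2 fun n => ae_all_iff.2 (hfiber n),
      ae_all_iff.2 fun n => ae_all_iff.2 (predictive_ae_eq μ n)] with ω hω hω₁ hω₂
    have hsum := tendsto_finsetSum Finset.univ fun a _ => hω a
    simp only [Finset.sum_const_zero] at hsum
    refine squeeze_zero (fun N => by positivity) (fun N => ?_) hsum
    rw [← Finset.mul_sum, Finset.sum_comm]
    refine mul_le_mul_of_nonneg_left (Finset.sum_le_sum fun n _ => ?_) (by positivity)
    refine (pi_norm_le_iff_of_nonneg (Finset.sum_nonneg fun _ _ => abs_nonneg _)).2 fun a => ?_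
    rw [Pi.sub_apply, Real.norm_eq_abs, hω₁ n a, hω₂ n a]
    exact Finset.single_le_sum (f := fun a =>
      |(μ[outcomeIndicator n a | MeasurableSpace.comap (initial n) inferInstance]) ω -
        (μ[outcomeIndicator n a | 𝒟 ⊔ MeasurableSpace.comap (initial n) inferInstance]) ω|)
      (fun _ _ => abs_nonneg _) (Finset.mem_univ a)
  filter_upwards [hκ.ae_ae (ae_measure_history_ne_zero μ), hκ.ae_ae hlim, hfib'] with θ hθ₁ hθ₂ hαθ
  filter_upwards [hθ₁, hθ₂, hαθ] with ω hω₁ hω₂ hαω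
  refine ⟨hω₁, ?_⟩
  rw [hαω] at hω₂
  simpa only [StrongCesaroTendsto, sub_zero, abs_norm] using hω₂

end Learnability

end Learning

theorem mainTheorem2 {A : Type*} [Fintype A] [MeasurableSpace A] [MeasurableSingletonClass A]
    (μ : Learning.Law A) [IsProbabilityMeasure μ] (hμ : Learning.IsStationary μ)
    (𝒟 : MeasurableSpace (ℤ → A)) (h𝒟 : 𝒟 ≤ MeasurableSpace.pi)
    (hinv : Learning.IsShiftInvariant 𝒟)
    (hpast : Learning.IsContainedMod μ 𝒟 (Learning.past A)) :
    (∃ (Θ : Type) (_ : MeasurableSpace Θ) (_ : StandardBorelSpace Θ)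
      (lam : Measure Θ) (κ : Θ → Learning.Law A),
      Learning.IsInducedDecomposition 𝒟 μ lam κ) ∧
    ∀ (Θ : Type*) [MeasurableSpace Θ] [StandardBorelSpace Θ]
      (lam : Measure Θ) (κ : Θ → Learning.Law A),
      Learning.IsInducedDecomposition 𝒟 μ lam κ → Learning.IsWeaklyLearnable μ lam κ :=
  ⟨Learning.exists_isInducedDecomposition (mΩ := MeasurableSpace.pi) μ h𝒟, fun _ _ _ _ _ h =>
    Learning.isWeaklyLearnable_of_isInducedDecomposition hμ h𝒟 hpast h⟩
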